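/- In the CongestedClique model there are $n$ machines with identifiers $1,\dots,n$, and the input is a graph $G$ on the vertex set $\{1,\dots,n\}$. Machine $v$ initially knows $n$, its identifier and the neighbours of $v$ in $G$, and has private randomness that is independent of that of the other machines. Computation proceeds in synchronous rounds. In each round every machine performs unbounded local computation and sends a (possibly different) message of $O(\log n)$ bits to each other machine. The number of rounds of an execution is the number of rounds after which all machines have irrevocably produced their outputs. Theorem. There is a randomized algorithm in the CongestedClique model which, given a length $\ell\ge 0$ known to all machines, on every simple graph $G$ with $n\ge 2$ vertices and no isolated vertex makes each machine $v$ output a sequence of vertices $(x_0,\dots,x_\ell)$ that is distributed exactly as the first $\ell$ steps of the simple random walk on $G$ started at $v$ (from each vertex the walk moves to a uniformly random neighbour; the walks of different machines need not be independent). Moreover, for all constants $c,a,K>0$ there is a constant $C$, depending only on $c,a,K$, such that for all $n\ge 2$, $\tau\ge 2$ and $\ell\le K\tau$, and for all such graphs $G$ on $n$ vertices, the following holds with probability at least $1-n^{-c}$: - if $\tau\ge a\,n/\log n$, the algorithm takes at most $C\,\frac{\tau}{n}\log\tau\log n$ rounds; - if $\tau\le a\,n/\log n$, the algorithm takes at most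 $C\log\tau$ rounds. The constant in the message length $O(\log n)$ is absolute. -/

import Mathlib

open MeasureTheory

/-- A randomized algorithm with outputs in `Out` on the clique of `n` machines with identifiers
in `Fin n`, where a message has `w` bits. Local computation is unrestricted. Randomness is private:
every machine draws its own seed from `seedLaw`, independently of the other machines. -/
structure CliqueAlgorithm (n w : ℕ) (Out : Type) where
  /-- Private random seeds. -/
  Seed : Type
  /-- There are countably many seeds. -/
  countable_seed : Countable Seed
  /-- The law of the seed of each machine. -/
  seedLaw : PMF Seed
  /-- Local memory contents of a machine. -/
  State : Type
  /-- The initial memory of a machine, from its identifier, the set of neighbours in the input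
  graph of the vertex that it hosts, and its own seed. -/
  init : Fin n → Finset (Fin n) → Seed → State
  /-- The message that a machine sends in a round to the machine with a given identifier. -/
  send : State → Fin n → (Fin w → Bool)
  /-- The new memory, from the old one and the messages received, indexed by their senders. -/
  recv : State → (Fin n → (Fin w → Bool)) → State
  /-- The output of a machine, `none` as long as it has not produced it. -/
  output : State → Option Out
  /-- An output is irrevocable. -/
  output_recv : ∀ s inbox o, output s = some o → output (recv s inbox) = some o

namespace CliqueAlgorithm

variable {n w : ℕ} {Out : Type} (𝒜 : CliqueAlgorithm n w Out)

instance : Countable 𝒜.Seed := 𝒜.countable_seed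

instance : MeasurableSpace 𝒜.Seed := ⊤

instance : DiscreteMeasurableSpace 𝒜.Seed := ⟨fun _ => trivial⟩

/-- The joint law of the independent seeds of the machines. -/
noncomputable def law : Measure (Fin n → 𝒜.Seed) :=
  Measure.pi fun _ => 𝒜.seedLaw.toMeasure

/-- The memories of all machines after `t` synchronous rounds on the input graph `G`, when the
machines have drawn the seeds `ω`. -/
def config (G : SimpleGraph (Fin n)) [DecidableRel G.Adj] (ω : Fin n → 𝒜.Seed) :
    ℕ → Fin n → 𝒜.State
  | 0 => fun v => 𝒜.init v (G.neighborFinset v) (ω v)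
  | t + 1 => fun v => 𝒜.recv (config G ω t v) fun u => 𝒜.send (config G ω t u) v

/-- The probability that machine `v` eventually outputs `x` on the input graph `G`. -/
noncomputable def outputProb (G : SimpleGraph (Fin n)) [DecidableRel G.Adj] (v : Fin n)
    (x : Out) : ℝ :=
  𝒜.law.real {ω | ∃ t, 𝒜.output (𝒜.config G ω t v) = some x}

/-- The probability that on the input graph `G` all machines have produced their outputs after at
most `R` rounds. -/
noncomputable def finishProb (G : SimpleGraph (Fin n)) [DecidableRel G.Adj] (R : ℝ) : ℝ :=
  𝒜.law.real {ω | ∃ t : ℕ, (t : ℝ) ≤ R ∧ ∀ v, (𝒜.output (𝒜.config G ω t v)).isSome}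

end CliqueAlgorithm

/-- Transition probabilities of the simple random walk on `G`. -/
noncomputable def transitionProb {n : ℕ} (G : SimpleGraph (Fin n)) [DecidableRel G.Adj]
    (u v : Fin n) : ℝ :=
  if G.Adj u v then (G.degree u : ℝ)⁻¹ else 0

/-- The probability that the first `ℓ` steps of the simple random walk on `G` from `v` run through
the vertices `x 0, x 1, …, x ℓ`. -/
noncomputable def walkProb {n : ℕ} (G : SimpleGraph (Fin n)) [DecidableRel G.Adj] (ℓ : ℕ)
    (v : Fin n) (x : Fin (ℓ + 1) → Fin n) : ℝ :=
  if x 0 = v then ∏ i : Fin ℓ, transitionProb G (x i.castSucc) (x i.succ) else 0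

/-! Every vertex fixes in advance a random neighbour for each step `q`, so step `q` becomes a random
map and all walks follow the same maps, coalescing when they meet. Each single walk keeps its law:
its steps read distinct coordinates of the seeds, even at revisited vertices. Since the seed law
cannot see `G`, a seed chooses from every nonempty vertex set. Composing the maps by doubling takes
`Nat.clog 2 ℓ` phases. One phase looks up, for every `v` and index `q`, an entry in the table of
another vertex. Making machine `r` the relay of one index per batch spreads `n` indices evenly: each
ordered pair of machines exchanges one pair of vertices per round. Hence the number of rounds is
deterministic and the time bounds hold with probability one. -/

/-! ### Composing a sequence of maps by doubling -/

/-- The composition `F (s + k - 1) ∘ ⋯ ∘ F s` of `k` maps. -/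
def iterateFrom {α : Type} (F : ℕ → α → α) (s : ℕ) : ℕ → α → α
  | 0, v => v
  | k + 1, v => F (s + k) (iterateFrom F s k v)

/-- Entry `q` of the table of `v` after `i` doubling phases. The table is cut into blocks of length
`2 ^ i`, and each block holds the trajectory of `v` under the maps whose indices lie in it. -/
def doublingTable {α : Type} (F : ℕ → α → α) : ℕ → α → ℕ → α
  | 0, v, q => F q v
  | i + 1, v, q =>
      if q / 2 ^ i % 2 = 1 then
        doublingTable F i (doublingTable F i v (q / 2 ^ i * 2 ^ i - 1)) q
      else doublingTable F i v q

theorem iterateFrom_add {α : Type} (F : ℕ → α → α) (s a b : ℕ) (v : α) :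
    iterateFrom F s (a + b) v = iterateFrom F (s + a) b (iterateFrom F s a v) := by
  induction b with
  | zero => rfl
  | succ b ih => rw [← Nat.add_assoc, iterateFrom, iterateFrom, ih, Nat.add_assoc]

/-- A block in an odd position is the second half of its parent block. The walk enters it at the
last entry of the first half, so composing the two trajectories extends the block; an even block is
already a prefix of its parent. -/
theorem doublingTable_eq_iterateFrom {α : Type} (F : ℕ → α → α) (i : ℕ) (v : α) (q : ℕ) :
    doublingTable F i v q = iterateFrom F (q / 2 ^ i * 2 ^ i) (q % 2 ^ i + 1) v := by
  induction i generalizing v q with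
  | zero => simp [doublingTable, iterateFrom, Nat.mod_one]
  | succ i ih =>
    have hpos : 0 < 2 ^ i := by positivity
    have hdiv : q / 2 ^ (i + 1) = q / 2 ^ i / 2 := by rw [pow_succ, Nat.div_div_eq_div_mul]
    have hmod : q % 2 ^ (i + 1) = q % 2 ^ i + 2 ^ i * (q / 2 ^ i % 2) := by
      rw [pow_succ, Nat.mod_mul]
    rw [doublingTable, hdiv, hmod]
    generalize hq : q / 2 ^ i = c
    split_ifs with h
    · obtain ⟨d, rfl⟩ : ∃ d, c = 2 * d + 1 := ⟨c / 2, by omega⟩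
      have hd : (2 * d + 1) / 2 = d := by omega
      have hlast : (2 * d + 1) * 2 ^ i - 1 = 2 ^ i - 1 + 2 ^ i * (2 * d) := by
        have : (2 * d + 1) * 2 ^ i = 2 ^ i + 2 ^ i * (2 * d) := by ring
        omega
      have hlt : 2 ^ i - 1 < 2 ^ i := by omega
      have hsum : q % 2 ^ i + 2 ^ i * ((2 * d + 1) % 2) + 1 = 2 ^ i + (q % 2 ^ i + 1) := by
        rw [h]
        ring
      have hstart : d * 2 ^ (i + 1) = 2 * d * 2 ^ i := by ring
      have hstart' : (2 * d + 1) * 2 ^ i = 2 * d * 2 ^ i + 2 ^ i := by ring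
      rw [ih v, ih, hq, hlast, Nat.add_mul_div_left _ _ hpos, Nat.div_eq_of_lt hlt, Nat.zero_add,
        Nat.add_mul_mod_self_left, Nat.mod_eq_of_lt hlt, Nat.sub_add_cancel hpos, hd, hsum, hstart,
        iterateFrom_add F _ (2 ^ i), hstart']
    · have hc : c % 2 = 0 := by omega
      have hc' : c / 2 * 2 ^ (i + 1) = c * 2 ^ i := by
        rw [pow_succ, mul_comm (2 ^ i), ← mul_assoc]
        congr 1
        omega
      rw [ih, hq, hc, hc', Nat.mul_zero, Nat.add_zero]

/-! ### Random neighbours -/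

/-- A choice of an element of each nonempty set of vertices, for each of `ℓ` steps. -/
abbrev NeighborSeed (n ℓ : ℕ) : Type :=
  (p : Fin ℓ × {S : Finset (Fin n) // S.Nonempty}) → {y : Fin n // y ∈ p.2.1}

instance (n ℓ : ℕ) : Nonempty (NeighborSeed n ℓ) :=
  ⟨fun p => ⟨p.2.2.choose, p.2.2.choose_spec⟩⟩

/-- The vertex to which `v` moves in step `q` when its neighbours are `S`. Beyond step `ℓ`, and
without neighbours, it stays. -/
def moveFrom {n ℓ : ℕ} (v : Fin n) (S : Finset (Fin n)) (s : NeighborSeed n ℓ) (q : ℕ) : Fin n :=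
  if h : q < ℓ ∧ S.Nonempty then (s (⟨q, h.1⟩, ⟨S, h.2⟩)).1 else v

theorem moveFrom_eq_iff {n ℓ : ℕ} {v : Fin n} {S : Finset (Fin n)} (hS : S.Nonempty)
    (s : NeighborSeed n ℓ) (j : Fin ℓ) (y : Fin n) :
    moveFrom v S s j = y ↔ (s (j, ⟨S, hS⟩)).1 = y := by
  simp [moveFrom, hS]

/-- Under the uniform law, the elements that are chosen in different steps from a set `S` are
independent and uniform in `S`. -/
theorem uniform_neighborSeed_real {n ℓ : ℕ} {S : Finset (Fin n)} (hS : S.Nonempty)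
    (P : Fin ℓ → Prop) [DecidablePred P] (y : Fin ℓ → Fin n)
    [MeasurableSpace (NeighborSeed n ℓ)] [DiscreteMeasurableSpace (NeighborSeed n ℓ)] :
    (PMF.uniformOfFintype (NeighborSeed n ℓ)).toMeasure.real
        {s | ∀ j, P j → (s (j, ⟨S, hS⟩)).1 = y j} =
      ∏ j, if P j then (if y j ∈ S then (S.card : ℝ)⁻¹ else 0) else 1 := by
  classical
  -- The event is a box: it restricts only the coordinates `(j, S)` with `P j`. All other factors
  -- are full and contribute ratio one.
  let A : (p : Fin ℓ × {S : Finset (Fin n) // S.Nonempty}) → Finset {y : Fin n // y ∈ p.2.1} :=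
    fun p => Finset.univ.filter fun z => p.2 = ⟨S, hS⟩ → P p.1 → z.1 = y p.1
  have hset : {s : NeighborSeed n ℓ | ∀ j, P j → (s (j, ⟨S, hS⟩)).1 = y j} =
      (Fintype.piFinset A : Set (NeighborSeed n ℓ)) := by
    ext s
    simp only [Set.mem_ofPred_eq, Finset.mem_coe, Fintype.mem_piFinset, A, Finset.mem_filter,
      Finset.mem_univ, true_and]
    constructor
    · rintro h ⟨j, S'⟩ rfl hP
      exact h j hP
    · intro h j hP
      exact h (j, ⟨S, hS⟩) rfl hP
  rw [hset, Measure.real, PMF.toMeasure_uniformOfFintype_apply _ (MeasurableSet.of_discrete)]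
  simp only [Fintype.card_coe, Finset.coe_sort_coe, ENNReal.toReal_div, ENNReal.toReal_natCast]
  rw [Fintype.card_piFinset, Fintype.card_pi, Nat.cast_prod, Nat.cast_prod,
    ← Finset.prod_div_distrib, Fintype.prod_prod_type]
  refine Finset.prod_congr rfl fun j _ => ?_
  have hcard : ∀ T : {S : Finset (Fin n) // S.Nonempty},
      (Fintype.card {y : Fin n // y ∈ T.1} : ℝ) ≠ 0 := fun T => by
    simpa using T.2.ne_empty
  rw [Finset.prod_eq_single ⟨S, hS⟩]
  · by_cases hP : P j
    · by_cases hy : y j ∈ S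
      · have : A (j, ⟨S, hS⟩) = {⟨y j, hy⟩} := by
          ext z
          simp [A, hP, Subtype.ext_iff]
        simp [this, hP, hy]
      · have : A (j, ⟨S, hS⟩) = ∅ := by
          ext z
          simp only [A, Finset.mem_filter, Finset.mem_univ, true_and, forall_const, hP,
            Finset.notMem_empty, iff_false]
          exact fun hz => hy (hz ▸ z.2)
        simp [this, hP, hy]
    · have : A (j, ⟨S, hS⟩) = Finset.univ := by simp [A, hP]
      rw [this, if_neg hP, Finset.card_univ]
      exact div_self (hcard _)
  · intro T _ hT
    have : A (j, T) = Finset.univ := by simp [A, hT]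
    rw [this, Finset.card_univ]
    exact div_self (hcard _)
  · simp

/-! ### The algorithm -/

theorem card_vertexPair_le (n : ℕ) :
    Fintype.card (Fin n × Fin n) ≤ Fintype.card (Fin (2 * Nat.clog 2 n) → Bool) := by
  have h : n ≤ 2 ^ Nat.clog 2 n := Nat.le_pow_clog (by norm_num) n
  simpa [two_mul, pow_add] using Nat.mul_le_mul h h

/-- A pair of vertices, written as a message. -/
noncomputable def encodePair (n : ℕ) : (Fin n × Fin n) ↪ (Fin (2 * Nat.clog 2 n) → Bool) :=
  (Function.Embedding.nonempty_of_card_le (card_vertexPair_le n)).some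

/-- The pair of vertices written in a message. -/
noncomputable def decodePair {n : ℕ} (v : Fin n) (x : Fin (2 * Nat.clog 2 n) → Bool) :
    Fin n × Fin n :=
  haveI : Nonempty (Fin n × Fin n) := ⟨(v, v)⟩
  Function.invFun (encodePair n) x

@[simp]
theorem decodePair_encodePair {n : ℕ} (v : Fin n) (x : Fin n × Fin n) :
    decodePair v (encodePair n x) = x :=
  haveI : Nonempty (Fin n × Fin n) := ⟨(v, v)⟩
  Function.leftInverse_invFun (encodePair n).injective x

/-- The memory of a machine: its identifier, a clock, the tables of all doubling phases so far, and
the messages that it received in its role as a relay. -/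
structure WalkState (n : ℕ) where
  id : Fin n
  time : ℕ
  table : ℕ → ℕ → Fin n
  buffer : Fin n → Fin n × Fin n

/-- The number of batches of `n` table entries. -/
def batches (n ℓ : ℕ) : ℕ := ℓ / n + 1

/-- The number of rounds that the algorithm takes. -/
def walkRounds (n ℓ : ℕ) : ℕ := 2 * (Nat.clog 2 ℓ * batches n ℓ)

/-- The messages that a machine sends. In each doubling phase, batches of `n` table entries are
treated one after the other, in two rounds each. Machine `r` is the relay of the `r`-th entry `q`
of the batch. In the first round it learns entry `q` of all tables and, for each `v`, the vertex at
which the block of `v` that precedes `q` ends. In the second round it sends entry `q` of that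
vertex to `v`. -/
noncomputable def walkSend {n : ℕ} (ℓ : ℕ) (s : WalkState n) (r : Fin n) :
    Fin (2 * Nat.clog 2 n) → Bool :=
  let i := s.time / 2 / batches n ℓ
  let q := s.time / 2 % batches n ℓ * n + r
  encodePair n <|
    if s.time % 2 = 0 then (s.table i q, s.table i (q / 2 ^ i * 2 ^ i - 1))
    else ((s.buffer (s.buffer r).2).1, s.id)

/-- The memory of a machine after it has received messages: in the first round of a batch they
fill its buffer, in the second round they give the entries of the batch in the next table. -/
noncomputable def walkRecv {n : ℕ} (ℓ : ℕ) (s : WalkState n)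
    (inbox : Fin n → (Fin (2 * Nat.clog 2 n) → Bool)) : WalkState n :=
  let i := s.time / 2 / batches n ℓ
  let b := s.time / 2 % batches n ℓ
  if walkRounds n ℓ ≤ s.time then s
  else if s.time % 2 = 0 then
    ⟨s.id, s.time + 1, s.table, fun u => decodePair s.id (inbox u)⟩
  else
    ⟨s.id, s.time + 1, fun i' q =>
      if i' = i + 1 ∧ q / n = b then
        if q / 2 ^ i % 2 = 1 then
          (decodePair s.id (inbox ⟨q % n, Nat.mod_lt _ s.id.pos⟩)).1
        else s.table i q
      else s.table i' q, s.buffer⟩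

/-- The output of a machine: after the last round, its walk is read off the last table. -/
def walkOutput {n : ℕ} (ℓ : ℕ) (s : WalkState n) : Option (Fin (ℓ + 1) → Fin n) :=
  if walkRounds n ℓ ≤ s.time then
    some (Fin.cons s.id fun j : Fin ℓ => s.table (Nat.clog 2 ℓ) j)
  else none

/-- The algorithm that builds a random walk with `ℓ` steps from each vertex. -/
noncomputable def walkAlgorithm (n ℓ : ℕ) :
    CliqueAlgorithm n (2 * Nat.clog 2 n) (Fin (ℓ + 1) → Fin n) where
  Seed := NeighborSeed n ℓ
  countable_seed := inferInstance
  seedLaw := PMF.uniformOfFintype (NeighborSeed n ℓ)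
  State := WalkState n
  init v S s := ⟨v, 0, fun _ q => moveFrom v S s q, fun _ => (v, v)⟩
  send := walkSend ℓ
  recv := walkRecv ℓ
  output := walkOutput ℓ
  output_recv s inbox o h := by
    have hs : walkRounds n ℓ ≤ s.time := by
      by_contra hs
      simp [walkOutput, hs] at h
    simpa [walkRecv, hs] using h

/-! ### Effect of a single round -/

section Step

variable {n ℓ k : ℕ} {s : WalkState n}

theorem walkSend_even (hs : s.time = 2 * k) (r : Fin n) :
    walkSend ℓ s r = encodePair n
      (s.table (k / batches n ℓ) (k % batches n ℓ * n + r),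
        s.table (k / batches n ℓ) ((k % batches n ℓ * n + r) / 2 ^ (k / batches n ℓ) *
          2 ^ (k / batches n ℓ) - 1)) := by
  simp [walkSend, hs]

theorem walkRecv_even (hs : s.time = 2 * k) (hk : k < Nat.clog 2 ℓ * batches n ℓ)
    (inbox : Fin n → (Fin (2 * Nat.clog 2 n) → Bool)) :
    walkRecv ℓ s inbox =
      (⟨s.id, 2 * k + 1, s.table, fun u => decodePair s.id (inbox u)⟩ : WalkState n) := by
  have : ¬ walkRounds n ℓ ≤ 2 * k := by rw [walkRounds]; omega
  simp [walkRecv, hs, this]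

theorem walkSend_odd (hs : s.time = 2 * k + 1) (r : Fin n) :
    walkSend ℓ s r =
      encodePair n ((s.buffer (s.buffer r).2).1, s.id) := by
  have h : (2 * k + 1) % 2 = 1 := by omega
  simp [walkSend, hs, h]

theorem walkRecv_odd (hs : s.time = 2 * k + 1) (hk : k < Nat.clog 2 ℓ * batches n ℓ)
    (inbox : Fin n → (Fin (2 * Nat.clog 2 n) → Bool)) :
    walkRecv ℓ s inbox =
      (⟨s.id, 2 * k + 2, fun i q =>
        if i = k / batches n ℓ + 1 ∧ q / n = k % batches n ℓ then
          if q / 2 ^ (k / batches n ℓ) % 2 = 1 then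
            (decodePair s.id (inbox ⟨q % n, Nat.mod_lt _ s.id.pos⟩)).1
          else s.table (k / batches n ℓ) q
        else s.table i q, s.buffer⟩ : WalkState n) := by
  have h : ¬ walkRounds n ℓ ≤ 2 * k + 1 := by rw [walkRounds]; omega
  have h1 : (2 * k + 1) % 2 = 1 := by omega
  have h2 : (2 * k + 1) / 2 = k := by omega
  simp [walkRecv, hs, h, h1, h2]

theorem walkOutput_eq_none (hs : s.time < walkRounds n ℓ) :
    walkOutput ℓ s = none := by
  simp [walkOutput, hs]

theorem walkOutput_eq_some (hs : walkRounds n ℓ ≤ s.time) :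
    walkOutput ℓ s =
      some (Fin.cons s.id fun j : Fin ℓ => s.table (Nat.clog 2 ℓ) j) := by
  simp [walkOutput, hs]

end Step

/-! ### Correctness of the execution -/

section Execution

variable {n ℓ : ℕ} (G : SimpleGraph (Fin n)) [DecidableRel G.Adj] (ω : Fin n → NeighborSeed n ℓ)

/-- The map that sends each vertex to the neighbour chosen in step `q`. -/
def moveMap (q : ℕ) (v : Fin n) : Fin n := moveFrom v (G.neighborFinset v) (ω v) q

/-- The memories of all machines after a number of rounds. -/
noncomputable def walkConfig : ℕ → Fin n → WalkState n
  | 0 => fun v => ⟨v, 0, fun _ q => moveMap G ω q v, fun _ => (v, v)⟩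
  | t + 1 => fun v => walkRecv ℓ (walkConfig t v) fun u => walkSend ℓ (walkConfig t u) v

theorem config_walkAlgorithm (t : ℕ) :
    (walkAlgorithm n ℓ).config G ω t = walkConfig G ω t := by
  induction t with
  | zero => rfl
  | succ t ih =>
    funext v
    change walkRecv ℓ ((walkAlgorithm n ℓ).config G ω t v)
      (fun u => walkSend ℓ ((walkAlgorithm n ℓ).config G ω t u) v) = _
    rw [ih]
    rfl

theorem output_config_walkAlgorithm (ω : Fin n → (walkAlgorithm n ℓ).Seed) (t : ℕ) (v : Fin n) :
    (walkAlgorithm n ℓ).output ((walkAlgorithm n ℓ).config G ω t v) =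
      walkOutput ℓ (walkConfig G ω t v) :=
  congrArg (walkOutput ℓ) (congrFun (config_walkAlgorithm G ω t) v)

theorem lt_batches_mul {q : ℕ} (hn : 0 < n) (hq : q < ℓ) : q < batches n ℓ * n := by
  have := Nat.lt_div_mul_add (a := ℓ) hn
  rw [batches, Nat.add_mul]
  omega

/-- Invariant: order the table entries by level, then by batch, giving `(i, q)` the position `i *
batches n ℓ + q / n`. Level 0 is known initially, and each pair of rounds completes one further
position. -/
theorem walkConfig_even (k : ℕ) (hk : k ≤ Nat.clog 2 ℓ * batches n ℓ) (v : Fin n) :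
    (walkConfig G ω (2 * k) v).id = v ∧ (walkConfig G ω (2 * k) v).time = 2 * k ∧
      ∀ i q, q < batches n ℓ * n → i * batches n ℓ + q / n < k + batches n ℓ →
        (walkConfig G ω (2 * k) v).table i q = doublingTable (moveMap G ω) i v q := by
  have hN : 0 < batches n ℓ := Nat.succ_pos _
  induction k generalizing v with
  | zero =>
    refine ⟨rfl, rfl, fun i q _ hi => ?_⟩
    obtain rfl : i = 0 := by
      by_contra h
      have := Nat.le_mul_of_pos_left (batches n ℓ) (Nat.pos_of_ne_zero h)
      have := Nat.zero_le (q / n)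
      omega
    rfl
  | succ k ih =>
    have hk' : k < Nat.clog 2 ℓ * batches n ℓ := hk
    obtain ⟨s, hs⟩ : ∃ s, s = walkConfig G ω (2 * k) := ⟨_, rfl⟩
    rw [← hs] at ih
    choose hid htime htab using ih hk'.le
    have hkib : k / batches n ℓ * batches n ℓ + k % batches n ℓ = k := Nat.div_add_mod' k _
    have hbN : k % batches n ℓ < batches n ℓ := Nat.mod_lt _ hN
    -- The level being doubled is already complete, so every entry that the batch reads is correct.
    have htab' : ∀ u q, q < batches n ℓ * n → q / n ≤ k % batches n ℓ + batches n ℓ →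
        (s u).table (k / batches n ℓ) q = doublingTable (moveMap G ω) (k / batches n ℓ) u q := by
      intro u q hq _
      refine htab u _ q hq ?_
      have := (Nat.div_lt_iff_lt_mul v.pos).2 hq
      omega
    have hodd : ∀ u, walkConfig G ω (2 * k + 1) u =
        (⟨u, 2 * k + 1, (s u).table, fun w =>
          ((s w).table (k / batches n ℓ) (k % batches n ℓ * n + u),
            (s w).table (k / batches n ℓ) ((k % batches n ℓ * n + u) / 2 ^ (k / batches n ℓ) *
              2 ^ (k / batches n ℓ) - 1))⟩ : WalkState n) := by
      intro u
      rw [walkConfig, ← hs]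
      beta_reduce
      rw [walkRecv_even (htime u) hk']
      simp only [walkSend_even (htime _), decodePair_encodePair, hid]
    have heven : walkConfig G ω (2 * (k + 1)) v =
        walkRecv ℓ (walkConfig G ω (2 * k + 1) v) fun u =>
          walkSend ℓ (walkConfig G ω (2 * k + 1) u) v := rfl
    simp only [hodd] at heven
    have hsend : ∀ (u r : Fin n) f g, walkSend ℓ ⟨u, 2 * k + 1, f, g⟩ r =
        encodePair n ((g (g r).2).1, u) := fun u r f g => walkSend_odd rfl r
    rw [walkRecv_odd rfl hk'] at heven
    simp only [hsend, decodePair_encodePair] at heven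
    rw [heven]
    refine ⟨rfl, rfl, fun i q hq hi => ?_⟩
    have hqN := (Nat.div_lt_iff_lt_mul v.pos).2 hq
    dsimp only
    split_ifs with h1 h2
    · have hbq : k % batches n ℓ * n + q % n = q := by rw [← h1.2]; exact Nat.div_add_mod' q n
      have hprev : q / 2 ^ (k / batches n ℓ) * 2 ^ (k / batches n ℓ) - 1 < batches n ℓ * n :=
        ((Nat.sub_le _ 1).trans (Nat.div_mul_le_self _ _)).trans_lt hq
      rw [h1.1, doublingTable, if_pos h2]
      simp only [hbq]
      rw [htab' v _ hprev, htab' _ q hq]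
      · omega
      · have := (Nat.div_lt_iff_lt_mul v.pos).2 hprev
        omega
    · rw [h1.1, doublingTable, if_neg h2, htab' v q hq (by omega)]
    · refine htab v i q hq ?_
      -- An entry at the new position `k + batches n ℓ` must, by division with remainder, lie in the
      -- batch just treated.
      by_contra hlt
      have heq : i * batches n ℓ + q / n = k + batches n ℓ := by omega
      have hi' : i = k / batches n ℓ + 1 := by
        have h3 : (q / n + batches n ℓ * i) / batches n ℓ = (k + batches n ℓ) / batches n ℓ := by
          rw [mul_comm, add_comm, heq]
        rwa [Nat.add_mul_div_left _ _ hN, Nat.div_eq_of_lt hqN, Nat.zero_add,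
          Nat.add_div_right _ hN] at h3
      refine h1 ⟨hi', ?_⟩
      rw [hi', Nat.add_mul, Nat.one_mul] at heq
      omega

theorem output_of_walkRounds_le (t : ℕ) (ht : walkRounds n ℓ ≤ t) (v : Fin n) :
    walkOutput ℓ (walkConfig G ω t v) =
      some fun j : Fin (ℓ + 1) => iterateFrom (moveMap G ω) 0 j v := by
  induction t, ht using Nat.le_induction with
  | base =>
    obtain ⟨hid, htime, htab⟩ := walkConfig_even G ω _ le_rfl v
    rw [walkRounds, walkOutput_eq_some htime.ge, hid]
    congr 1
    funext j
    refine Fin.cases rfl (fun j => ?_) j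
    have hlt := lt_batches_mul v.pos j.2
    -- At the last level one block starting at 0 covers all indices below `ℓ`; entry `j` is the
    -- vertex after `j + 1` steps.
    have hpow : (j : ℕ) < 2 ^ Nat.clog 2 ℓ := j.2.trans_le (Nat.le_pow_clog (by norm_num) ℓ)
    rw [Fin.cons_succ, htab _ _ hlt
      (Nat.add_lt_add_left ((Nat.div_lt_iff_lt_mul v.pos).2 hlt) _),
      doublingTable_eq_iterateFrom, Nat.div_eq_of_lt hpow, Nat.mod_eq_of_lt hpow]
    simp
  | succ t _ ih => exact (walkAlgorithm n ℓ).output_recv _ _ _ ih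

theorem time_walkConfig_le (t : ℕ) (v : Fin n) :
    (walkConfig G ω t v).time ≤ t := by
  induction t with
  | zero => exact le_rfl
  | succ t ih =>
    simp only [walkConfig, walkRecv]
    split_ifs
    · exact ih.trans (Nat.le_succ t)
    · exact Nat.succ_le_succ ih
    · exact Nat.succ_le_succ ih

/-- The clock never runs ahead of the rounds, so nothing is output before round `walkRounds n ℓ`;
afterwards the output is constant. -/
theorem exists_output_eq_some_iff (v : Fin n) (x : Fin (ℓ + 1) → Fin n) :
    (∃ t, walkOutput ℓ (walkConfig G ω t v) = some x) ↔
      ∀ j : Fin (ℓ + 1), iterateFrom (moveMap G ω) 0 j v = x j := by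
  have key := fun t ht => output_of_walkRounds_le G ω t ht v
  constructor
  · rintro ⟨t, ht⟩
    rcases lt_or_ge t (walkRounds n ℓ) with h | h
    · rw [walkOutput_eq_none ((time_walkConfig_le G ω t v).trans_lt h)] at ht
      cases ht
    · rw [key t h] at ht
      exact congrFun (Option.some.inj ht)
  · intro h
    refine ⟨_, (key _ le_rfl).trans ?_⟩
    rw [funext h]

/-- Splits a prescribed path into one condition per step, so that condition `j` involves only the
seed of `x j`. -/
theorem forall_iterateFrom_eq_iff {α : Type} (F : ℕ → α → α) (v : α) (x : Fin (ℓ + 1) → α) :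
    (∀ j : Fin (ℓ + 1), iterateFrom F 0 j v = x j) ↔
      x 0 = v ∧ ∀ j : Fin ℓ, F j (x j.castSucc) = x j.succ := by
  constructor
  · intro h
    refine ⟨(h 0).symm, fun j => ?_⟩
    rw [← h j.castSucc, ← h j.succ]
    simp [iterateFrom]
  · rintro ⟨h0, h⟩ j
    induction j using Fin.induction with
    | zero => exact h0.symm
    | succ j ih =>
      rw [← h j, ← ih]
      simp [iterateFrom]

end Execution

/-! ### Law of the output -/

/-- Grouping the step conditions by the vertex being left makes the event a product over the
independent seeds. After exchanging the products over vertices and steps, step `j` retains only the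
factor of the vertex `x j`. -/
theorem outputProb_walkAlgorithm {n ℓ : ℕ} (G : SimpleGraph (Fin n)) [DecidableRel G.Adj]
    (hG : ∀ v, 0 < G.degree v) (v : Fin n) (x : Fin (ℓ + 1) → Fin n) :
    (walkAlgorithm n ℓ).outputProb G v x = walkProb G ℓ v x := by
  have hne : ∀ u, (G.neighborFinset u).Nonempty := fun u => Finset.card_pos.1 (hG u)
  rw [CliqueAlgorithm.outputProb, walkProb]
  split_ifs with h0
  · obtain ⟨A, hA⟩ : ∃ A : Fin n → Set (walkAlgorithm n ℓ).Seed, A = fun u =>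
        {s : NeighborSeed n ℓ | ∀ j : Fin ℓ, x j.castSucc = u →
          (s (j, ⟨G.neighborFinset u, hne u⟩)).1 = x j.succ} := ⟨_, rfl⟩
    have hset : {ω | ∃ t, (walkAlgorithm n ℓ).output ((walkAlgorithm n ℓ).config G ω t v) =
        some x} = Set.univ.pi A := by
      ext ω
      rw [Set.mem_ofPred_eq, Set.mem_univ_pi, hA]
      simp only [output_config_walkAlgorithm]
      refine (exists_output_eq_some_iff G ω v x).trans ((forall_iterateFrom_eq_iff _ v x).trans ?_)
      refine ⟨fun h u j hu => ?_, fun h => ⟨h0, fun j => ?_⟩⟩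
      · subst hu
        exact (moveFrom_eq_iff (hne _) _ j _).1 (h.2 j)
      · exact (moveFrom_eq_iff (hne _) _ j _).2 (h _ j rfl)
    have hprob : ∀ u, ((walkAlgorithm n ℓ).seedLaw.toMeasure (A u)).toReal =
        ∏ j : Fin ℓ, if x j.castSucc = u then
          (if x j.succ ∈ G.neighborFinset u then ((G.neighborFinset u).card : ℝ)⁻¹ else 0)
        else 1 := fun u => by
      rw [hA]
      exact @uniform_neighborSeed_real n ℓ _ (hne u) (fun j => x j.castSucc = u) _
        (fun j => x j.succ) ⊤ (@DiscreteMeasurableSpace.mk _ ⊤ fun _ => trivial)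
    rw [hset, CliqueAlgorithm.law, measureReal_def, Measure.pi_pi, ENNReal.toReal_prod,
      Finset.prod_congr rfl fun u _ => hprob u, Finset.prod_comm]
    refine Finset.prod_congr rfl fun j _ => ?_
    rw [Finset.prod_ite_eq, if_pos (Finset.mem_univ _)]
    simp [transitionProb]
  · have hset : {ω | ∃ t, (walkAlgorithm n ℓ).output ((walkAlgorithm n ℓ).config G ω t v) =
        some x} = ∅ := by
      refine Set.eq_empty_of_forall_notMem fun ω hω => h0 ?_
      rw [Set.mem_ofPred_eq] at hω
      simp only [output_config_walkAlgorithm] at hω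
      exact ((forall_iterateFrom_eq_iff _ v x).1 ((exists_output_eq_some_iff G ω v x).1 hω)).1
    rw [hset, measureReal_empty]

/-! ### Number of rounds -/

theorem finishProb_walkAlgorithm {n ℓ : ℕ} (G : SimpleGraph (Fin n)) [DecidableRel G.Adj] {R : ℝ}
    (hR : (walkRounds n ℓ : ℝ) ≤ R) : (walkAlgorithm n ℓ).finishProb G R = 1 := by
  have hset : {ω | ∃ t : ℕ, (t : ℝ) ≤ R ∧
      ∀ v, ((walkAlgorithm n ℓ).output ((walkAlgorithm n ℓ).config G ω t v)).isSome} =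
        Set.univ := by
    refine Set.eq_univ_of_forall fun ω => ⟨walkRounds n ℓ, hR, fun v => ?_⟩
    rw [output_config_walkAlgorithm]
    exact Option.isSome_of_eq_some (output_of_walkRounds_le G ω _ le_rfl v)
  have : IsProbabilityMeasure (walkAlgorithm n ℓ).law := by
    unfold CliqueAlgorithm.law
    infer_instance
  rw [CliqueAlgorithm.finishProb, hset, probReal_univ]

/-- Take logarithms in `2 ^ (Nat.clog 2 ℓ - 1) < ℓ ≤ (K + 1) * τ`. Using `K + 1` keeps the
constant's logarithm nonnegative, and `log τ ≥ log 2` absorbs the additive terms. -/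
theorem clog_two_le_mul_log {K : ℝ} {τ ℓ : ℕ} (hK : 0 < K) (hτ : 2 ≤ τ) (hℓ : (ℓ : ℝ) ≤ K * τ) :
    (Nat.clog 2 ℓ : ℝ) ≤
      ((Real.log (K + 1) / Real.log 2 + 1) / Real.log 2 + 1 / Real.log 2) * Real.log τ := by
  have hlog2 : 0 < Real.log 2 := Real.log_pos (by norm_num)
  have hτ' : (2 : ℝ) ≤ τ := by exact_mod_cast hτ
  have hlogτ : Real.log 2 ≤ Real.log τ := Real.log_le_log (by norm_num) hτ'
  have hK1 : 0 ≤ Real.log (K + 1) := Real.log_nonneg (by linarith)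
  rcases Nat.eq_zero_or_pos (Nat.clog 2 ℓ) with h | h
  · rw [h, Nat.cast_zero]
    exact mul_nonneg (by positivity) (hlog2.le.trans hlogτ)
  · have hpow : 2 ^ (Nat.clog 2 ℓ - 1) < ℓ :=
      Nat.pow_pred_clog_lt_self (by norm_num) (by
        by_contra hle
        rw [Nat.clog_of_right_le_one (by omega)] at h
        exact lt_irrefl _ h)
    have hle : (2 : ℝ) ^ (Nat.clog 2 ℓ - 1) ≤ (K + 1) * τ :=
      calc (2 : ℝ) ^ (Nat.clog 2 ℓ - 1) ≤ ℓ := by exact_mod_cast hpow.le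
        _ ≤ (K + 1) * τ := by nlinarith
    have hlog := Real.log_le_log (by positivity) hle
    rw [Real.log_pow, Real.log_mul (by positivity) (by positivity), Nat.cast_sub h, Nat.cast_one]
      at hlog
    have h1 : (Real.log (K + 1) / Real.log 2 + 1) ≤
        (Real.log (K + 1) / Real.log 2 + 1) / Real.log 2 * Real.log τ := by
      rw [div_mul_eq_mul_div, le_div_iff₀ hlog2]
      exact mul_le_mul_of_nonneg_left hlogτ (by positivity)
    have h2 : (Nat.clog 2 ℓ : ℝ) - 1 ≤ (Real.log (K + 1) + Real.log τ) / Real.log 2 :=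
      (le_div_iff₀ hlog2).2 hlog
    rw [add_div] at h2
    rw [add_mul, div_mul_eq_mul_div 1, one_mul]
    linarith

theorem walkRounds_le {K : ℝ} {n τ ℓ : ℕ} (hK : 0 < K) (hτ : 2 ≤ τ) (hℓ : (ℓ : ℝ) ≤ K * τ) :
    (walkRounds n ℓ : ℝ) ≤
      2 * ((Real.log (K + 1) / Real.log 2 + 1) / Real.log 2 + 1 / Real.log 2) * Real.log τ *
        (K * (τ / n) + 1) := by
  have hN : (batches n ℓ : ℝ) ≤ K * (τ / n) + 1 := by
    rw [batches, Nat.cast_add, Nat.cast_one, ← mul_div_assoc]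
    gcongr
    exact Nat.cast_div_le.trans (by gcongr)
  rw [walkRounds, Nat.cast_mul, Nat.cast_mul, Nat.cast_ofNat, mul_assoc 2, mul_assoc 2]
  have hD := clog_two_le_mul_log hK hτ hℓ
  gcongr
  exact (Nat.cast_nonneg _).trans hD

theorem mainTheorem2 :
    -- messages have `B * ⌈log₂ n⌉` bits; `𝒜 n ℓ` builds walks with `ℓ` steps on `n` machines
    ∃ (B : ℕ) (𝒜 : (n ℓ : ℕ) → CliqueAlgorithm n (B * Nat.clog 2 n) (Fin (ℓ + 1) → Fin n)),
      -- the output of each machine `v` is distributed as a random walk from `v`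
      (∀ (n ℓ : ℕ) (G : SimpleGraph (Fin n)) [DecidableRel G.Adj], 2 ≤ n →
        (∀ v, 0 < G.degree v) →
        ∀ (v : Fin n) (x : Fin (ℓ + 1) → Fin n),
          (𝒜 n ℓ).outputProb G v x = walkProb G ℓ v x) ∧
      -- round complexity, with high probability, for walks with at most `K * τ` steps
      (∀ c a K : ℝ, 0 < c → 0 < a → 0 < K → ∃ C : ℝ, 0 < C ∧
        ∀ (n τ ℓ : ℕ) (G : SimpleGraph (Fin n)) [DecidableRel G.Adj], 2 ≤ n → 2 ≤ τ →
          (ℓ : ℝ) ≤ K * τ → (∀ v, 0 < G.degree v) →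
          (a * (n / Real.log n) ≤ τ →
            1 - (n : ℝ) ^ (-c) ≤
              (𝒜 n ℓ).finishProb G (C * (τ / n * Real.log τ * Real.log n))) ∧
          ((τ : ℝ) ≤ a * (n / Real.log n) →
            1 - (n : ℝ) ^ (-c) ≤ (𝒜 n ℓ).finishProb G (C * Real.log τ))) := by
  refine ⟨2, walkAlgorithm, fun n ℓ G _ _ hG => outputProb_walkAlgorithm G hG, ?_⟩
  intro c a K hc ha hK
  have hlog2 : 0 < Real.log 2 := Real.log_pos (by norm_num)
  have hK1 : 0 ≤ Real.log (K + 1) := Real.log_nonneg (by linarith)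
  obtain ⟨D, hD⟩ : ∃ D, D =
      2 * ((Real.log (K + 1) / Real.log 2 + 1) / Real.log 2 + 1 / Real.log 2) := ⟨_, rfl⟩
  have hDpos : 0 < D := by rw [hD]; positivity
  -- One summand per regime. For large `τ`, the `1` in `K * (τ / n) + 1` is absorbed by `τ / n * log
  -- n ≥ a`, and the other term by `log n ≥ log 2`. For small `τ`, `τ / n ≤ a / log 2`.
  refine ⟨D * (K / Real.log 2 + 1 / a) + D * (K * (a / Real.log 2) + 1), by positivity, ?_⟩
  intro n τ ℓ G _ hn hτ hℓ hG
  have hn' : (2 : ℝ) ≤ n := by exact_mod_cast hn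
  have hlogn : Real.log 2 ≤ Real.log n := Real.log_le_log (by norm_num) hn'
  have hlogn0 : 0 < Real.log n := hlog2.trans_le hlogn
  have hlogτ : 0 < Real.log τ := Real.log_pos (by exact_mod_cast hτ)
  have hrounds := walkRounds_le (n := n) hK hτ hℓ
  rw [← hD] at hrounds
  have hn0 : (0 : ℝ) < n := by linarith
  have hτ0 : (0 : ℝ) < τ := by exact_mod_cast (by omega : 0 < τ)
  have hp : 1 - (n : ℝ) ^ (-c) ≤ 1 := sub_le_self _ (by positivity)
  refine ⟨fun hlarge => ?_, fun hsmall => ?_⟩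
  · rwa [finishProb_walkAlgorithm]
    have h1 : 1 ≤ 1 / a * (τ / n * Real.log n) := by
      rw [← mul_div_assoc, div_le_iff₀ hlogn0] at hlarge
      rw [one_div, ← div_eq_inv_mul, le_div_iff₀ ha, div_mul_eq_mul_div, le_div_iff₀ hn0]
      linarith
    have h2 : K * (τ / n) ≤ K / Real.log 2 * (τ / n * Real.log n) := by
      rw [div_mul_eq_mul_div, le_div_iff₀ hlog2, mul_assoc]
      gcongr
    calc (walkRounds n ℓ : ℝ) ≤ D * Real.log τ * (K * (τ / n) + 1) := hrounds
      _ ≤ D * Real.log τ * ((K / Real.log 2 + 1 / a) * (τ / n * Real.log n)) := by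
        gcongr
        linarith
      _ = D * (K / Real.log 2 + 1 / a) * (τ / n * Real.log τ * Real.log n) := by ring
      _ ≤ _ := by
        gcongr
        exact le_add_of_nonneg_right (by positivity)
  · rwa [finishProb_walkAlgorithm]
    have h1 : (τ : ℝ) / n ≤ a / Real.log 2 := by
      rw [div_le_iff₀ hn0, div_mul_eq_mul_div]
      refine hsmall.trans ?_
      rw [← mul_div_assoc]
      gcongr
    calc (walkRounds n ℓ : ℝ) ≤ D * Real.log τ * (K * (τ / n) + 1) := hrounds
      _ ≤ D * Real.log τ * (K * (a / Real.log 2) + 1) := by gcongr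
      _ = D * (K * (a / Real.log 2) + 1) * Real.log τ := by ring
      _ ≤ _ := by
        gcongr
        exact le_add_of_nonneg_left (by positivity)
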